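/- Let $n\ge 1$ be an integer, $a_1^\pm>0$, and let $b_k^\pm$ ($2\le k\le n$) be real numbers with $b_2^\pm>0$ if $n\ge 2$. Put $$F_-(x)=(-1)^{n+1}x^{n+1}+\sum_{k=2}^{n} b_k^-x^k,\quad F_+(x)=x^{n+1}+\sum_{k=2}^{n} b_k^+x^k,\quad G_\pm(x)=-a_1^\pm x,$$ and assume $F_-'(x)<0$ for all $x<0$ and $F_+'(x)>0$ for all $x>0$. Consider the piecewise smooth classical Liénard system $\dot x=y-F_-(x),\ \dot y=\epsilon G_-(x)$ for $x\le 0$, $\dot x=y-F_+(x),\ \dot y=\epsilon G_+(x)$ for $x\ge 0$. For $y>0$ let $\alpha(y)<0<\omega(y)$ be given by $F_-(\alpha(y))=y=F_+(\omega(y))$, and let $$I_-(y)=-\int_{\alpha(y)}^0\frac{F_-'(x)^2}{G_-(x)}\,dx,\quad I_+(y)=-\int_{\omega(y)}^0\frac{F_+'(x)^2}{G_+(x)}\,dx,\quad I=I_+-I_-$$ be its slow divergence integrals. The slow relation function $H:\,]0,\infty[\,\to\,]0,\infty[$ is defined by $I_-(H(y))=I_+(y)$, and its inverse by $I_-(y)=I_+(H^{-1}(y))$.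 Suppose $y^*>0$ is such that $I(y)\ne 0$ for all $y>y^*$, and let $y_0>y^*$. Let $f_k=b_k^++(-1)^{k+1}b_k^-$ ($2\le k\le n$), so that $F_+(x)-F_-(-x)=\sum_{k=2}^n f_kx^k$. For $V\subset\mathbb R$ bounded, $s\ge 0$, let $V_\delta=\{x : \mathrm{dist}(x,V)\le\delta\}$, let $\mathcal M_*^s(V)$ and $\mathcal M^{*s}(V)$ be the lower and upper limits of $|V_\delta|/\delta^{1-s}$ as $\delta\to0^+$, and let $\underline{\dim}_BV=\inf\{s\ge0:\mathcal M_*^s(V)=0\}$, $\overline{\dim}_BV=\inf\{s\ge0:\mathcal M^{*s}(V)=0\}$; if they coincide, the common value is $\dim_BV$. $V$ is Minkowski nondegenerate if $0<\mathcal M_*^d(V)\le\mathcal M^{*d}(V)<\infty$ for some $d$. For an orbit $U=\{y_l : l\in\mathbb N\}$ tending to $+\infty$, the Minkowski dimension and Minkowski nondegeneracy of $U$ are those of $\{y_l^{-1/(n+1)} : l\in\mathbb N\}$. Then, for every such $y_0$: 1. If $a_1^->a_1^+$ (resp. $a_1^-<a_1^+$), then the orbit $U$ of $y_0$ by $H$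 (resp. by $H^{-1}$) tends monotonically to $+\infty$ and $\dim_BU=0$. 2. Suppose $a_1^-=a_1^+$, some $f_k$ is nonzero, and $k_0=\max\{k : f_k\ne0\}$ satisfies $k_0\ne n-1$. If $f_{k_0}(1+k_0-n)>0$ (resp. $<0$), then the orbit $U$ of $y_0$ by $H$ (resp. by $H^{-1}$) tends monotonically to $+\infty$, $U$ is Minkowski nondegenerate, and $$\dim_BU=\frac{n+1-k_0}{n+2-k_0}.$$ -/

import Mathlib

open Filter Topology MeasureTheory

namespace PWSLienard

noncomputable section

/-! ### Minkowski content and Minkowski (box) dimension of subsets of the real line -/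

/-- Lower `s`-dimensional Minkowski content: the lower limit, as `δ → 0⁺`, of
`|U_δ| / δ ^ (1 - s)`, where `U_δ` is the closed `δ`-neighbourhood of `U`. -/
def lowerMinkowskiContent (s : ℝ) (U : Set ℝ) : ENNReal :=
  liminf (fun δ : ℝ => volume (Metric.cthickening δ U) / ENNReal.ofReal (δ ^ (1 - s))) (𝓝[>] 0)

/-- Upper `s`-dimensional Minkowski content. -/
def upperMinkowskiContent (s : ℝ) (U : Set ℝ) : ENNReal :=
  limsup (fun δ : ℝ => volume (Metric.cthickening δ U) / ENNReal.ofReal (δ ^ (1 - s))) (𝓝[>] 0)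

/-- Lower Minkowski dimension. -/
def lowerMinkowskiDim (U : Set ℝ) : ℝ :=
  sInf {s : ℝ | 0 ≤ s ∧ lowerMinkowskiContent s U = 0}

/-- Upper Minkowski dimension. -/
def upperMinkowskiDim (U : Set ℝ) : ℝ :=
  sInf {s : ℝ | 0 ≤ s ∧ upperMinkowskiContent s U = 0}

/-- The Minkowski dimension of `U` exists and equals `d`. -/
def HasMinkowskiDim (U : Set ℝ) (d : ℝ) : Prop :=
  lowerMinkowskiDim U = d ∧ upperMinkowskiDim U = d

/-- `U` is Minkowski nondegenerate. -/
def MinkowskiNondegenerate (U : Set ℝ) : Prop :=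
  ∃ d : ℝ, 0 ≤ d ∧ 0 < lowerMinkowskiContent d U ∧
    lowerMinkowskiContent d U ≤ upperMinkowskiContent d U ∧ upperMinkowskiContent d U < ⊤

/-! ### Slow divergence integrals and the slow relation function of
`x' = y - F_±(x)`, `y' = ε G_±(x)` (`-` on `x ≤ 0`, `+` on `x ≥ 0`) -/

/-- `α(y) < 0` with `F_-(α(y)) = y`. -/
def alpha (Fm : ℝ → ℝ) (y : ℝ) : ℝ := Function.invFunOn Fm (Set.Iio 0) y

/-- `ω(y) > 0` with `F_+(ω(y)) = y`. -/
def omega (Fp : ℝ → ℝ) (y : ℝ) : ℝ := Function.invFunOn Fp (Set.Ioi 0) y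

/-- The slow divergence integral `I_-` along `[α(y), 0]`. -/
def IMinus (Fm Gm : ℝ → ℝ) (y : ℝ) : ℝ :=
  -∫ x in (alpha Fm y)..0, (deriv Fm x) ^ 2 / Gm x

/-- The slow divergence integral `I_+` along `[0, ω(y)]`. -/
def IPlus (Fp Gp : ℝ → ℝ) (y : ℝ) : ℝ :=
  -∫ x in (omega Fp y)..0, (deriv Fp x) ^ 2 / Gp x

/-- `I = I_+ - I_-`. -/
def ITotal (Fm Gm Fp Gp : ℝ → ℝ) (y : ℝ) : ℝ := IPlus Fp Gp y - IMinus Fm Gm y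

/-- The slow relation function: `H(y) > 0` with `I_-(H(y)) = I_+(y)`. -/
def slowRelation (Fm Gm Fp Gp : ℝ → ℝ) (y : ℝ) : ℝ :=
  Function.invFunOn (IMinus Fm Gm) (Set.Ioi 0) (IPlus Fp Gp y)

/-- The inverse of the slow relation function: `H⁻¹(y) > 0` with `I_-(y) = I_+(H⁻¹(y))`. -/
def slowRelationInv (Fm Gm Fp Gp : ℝ → ℝ) (y : ℝ) : ℝ :=
  Function.invFunOn (IPlus Fp Gp) (Set.Ioi 0) (IMinus Fm Gm y)

/-! ### Classical Liénard equations of degree `n + 1` -/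

/-- `F_-(x) = (-1)^(n+1) x^(n+1) + ∑_{k=2}^n b_k^- x^k`. -/
def FMinus (n : ℕ) (bm : ℕ → ℝ) (x : ℝ) : ℝ :=
  (-1) ^ (n + 1) * x ^ (n + 1) + ∑ k ∈ Finset.Icc 2 n, bm k * x ^ k

/-- `F_+(x) = x^(n+1) + ∑_{k=2}^n b_k^+ x^k`. -/
def FPlus (n : ℕ) (bp : ℕ → ℝ) (x : ℝ) : ℝ :=
  x ^ (n + 1) + ∑ k ∈ Finset.Icc 2 n, bp k * x ^ k

/-- `G(x) = -a x`. -/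
def GLin (a : ℝ) (x : ℝ) : ℝ := -a * x

/-- The coefficients `f_k`, `2 ≤ k ≤ n`, of `F_+(x) - F_-(-x)`. -/
def fCoeff (bm bp : ℕ → ℝ) (k : ℕ) : ℝ := bp k + (-1) ^ (k + 1) * bm k

theorem FPlus_sub_FMinus_neg (n : ℕ) (bm bp : ℕ → ℝ) (x : ℝ) :
    FPlus n bp x - FMinus n bm (-x) = ∑ k ∈ Finset.Icc 2 n, fCoeff bm bp k * x ^ k := by
  have h1 : (-1 : ℝ) ^ (n + 1) * (-x) ^ (n + 1) = x ^ (n + 1) := by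
    rw [← mul_pow]; simp
  have h2 : ∀ k : ℕ, fCoeff bm bp k * x ^ k = bp k * x ^ k - bm k * (-x) ^ k := by
    intro k
    rw [fCoeff, neg_pow x k, pow_succ]
    ring
  simp only [FPlus, FMinus, h1, h2, Finset.sum_sub_distrib]
  ring

/-- The image, under `y ↦ r = 1 / y^(1/(n+1))`, of the orbit `{T^l(y₀) | l ∈ ℕ}`. Its Minkowski
dimension is, by definition, the Minkowski dimension of the orbit near infinity. -/
def orbitAtInfinity (n : ℕ) (T : ℝ → ℝ) (y₀ : ℝ) : Set ℝ :=
  Set.range fun l : ℕ => 1 / (T^[l] y₀) ^ ((1 : ℝ) / ((n : ℝ) + 1))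

/-- The orbit of `y₀` by `T` tends monotonically to `+∞`. -/
def OrbitTendsToInfinity (T : ℝ → ℝ) (y₀ : ℝ) : Prop :=
  StrictMono (fun l : ℕ => T^[l] y₀) ∧ Tendsto (fun l : ℕ => T^[l] y₀) atTop atTop

end

end PWSLienard

open PWSLienard

namespace PWSLienard

open Polynomial

/-! Reflecting the left branch, x ↦ -x, turns both branches into monic polynomials `P` of degree n+1
increasing on the positive half-line. With `E` the primitive of P'²/x vanishing at 0 and `w` the
inverse of `P`, each slow divergence integral is -E(w(y))/a. So `H` and its inverse are one
construction with the roles of the branches exchanged: E₁(w₁(Ty))/a₁ = E₂(w₂(y))/a₂.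

In the scale ρ = y^(1/(n+1)) one has w ~ ρ, hence E(w) ~ (n+1)²/(2n) · ρ^(2n). If a₂ < a₁, then
ρ(Ty)/ρ(y) tends to (a₁/a₂)^(1/(2n)) > 1; the orbit grows geometrically and has dimension 0
(`geometric_orbit`).

If a₁ = a₂, the leading terms cancel. With k the top index and f the top coefficient of P₂ - P₁,
`tendsto_energy_sub` gives E₂(w₂) - E₁(w₁) ~ (n+1) f (1+k-n)/(n+k-1) · ρ^(n+k-1). The mean value
theorem converts this into ρ(Ty) - ρ(y) ~ const · ρ^(k-n) (`tendsto_rho_increment`). With q = n+1-k,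
ρ^q therefore grows linearly along the orbit, 1/ρ behaves like l^(-1/q), and the dimension is
q/(q+1) (`minkowski_of_power_growth`, `power_orbit`).

The orbit is monotone because `I` has no zero beyond y*, so its sign there is the one dictated by
the asymptotics (`orbitTendsToInfinity_of_lt`). -/

/-! ### Minkowski contents and the dimension they determine -/

theorem lowerMinkowskiContent_le_upper (s : ℝ) (U : Set ℝ) :
    lowerMinkowskiContent s U ≤ upperMinkowskiContent s U :=
  liminf_le_limsup

theorem upperMinkowskiContent_lt_top {d C : ℝ} {U : Set ℝ}
    (h : ∀ᶠ δ in 𝓝[>] (0 : ℝ),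
      volume (Metric.cthickening δ U) ≤ ENNReal.ofReal (C * δ ^ (1 - d))) :
    upperMinkowskiContent d U < ⊤ := by
  refine lt_of_le_of_lt (limsup_le_of_le (a := ENNReal.ofReal C) (by isBoundedDefault) ?_)
    ENNReal.ofReal_lt_top
  filter_upwards [h, self_mem_nhdsWithin] with δ hδ hpos
  have hp : 0 < δ ^ (1 - d) := Real.rpow_pos_of_pos hpos _
  refine ENNReal.div_le_of_le_mul ?_
  rwa [← ENNReal.ofReal_mul' hp.le]

theorem lowerMinkowskiContent_pos {d c : ℝ} {U : Set ℝ} (hc : 0 < c)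
    (h : ∀ᶠ δ in 𝓝[>] (0 : ℝ),
      ENNReal.ofReal (c * δ ^ (1 - d)) ≤ volume (Metric.cthickening δ U)) :
    0 < lowerMinkowskiContent d U := by
  refine lt_of_lt_of_le (ENNReal.ofReal_pos.2 hc)
    (le_liminf_of_le (a := ENNReal.ofReal c) (by isBoundedDefault) ?_)
  filter_upwards [h, self_mem_nhdsWithin] with δ hδ hpos
  have hp : 0 < δ ^ (1 - d) := Real.rpow_pos_of_pos hpos _
  rw [ENNReal.le_div_iff_mul_le (Or.inl (ENNReal.ofReal_pos.2 hp).ne')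
    (Or.inl ENNReal.ofReal_ne_top)]
  rwa [← ENNReal.ofReal_mul' hp.le]

theorem upperMinkowskiContent_eq_zero {d s : ℝ} {U : Set ℝ}
    (h : upperMinkowskiContent d U < ⊤) (hds : d < s) : upperMinkowskiContent s U = 0 := by
  obtain ⟨C, hC, hCtop⟩ := exists_between h
  have hev := eventually_lt_of_limsup_lt hC
  have hlim : Tendsto (fun δ : ℝ => C * ENNReal.ofReal (δ ^ (s - d))) (𝓝[>] 0) (𝓝 0) := by
    have h1 : Tendsto (fun δ : ℝ => δ ^ (s - d)) (𝓝[>] 0) (𝓝 0) := by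
      have := (Real.continuousAt_rpow_const (0 : ℝ) (s - d) (Or.inr (by linarith))).tendsto
      rw [Real.zero_rpow (by linarith)] at this
      exact this.mono_left nhdsWithin_le_nhds
    have h2 := ENNReal.Tendsto.const_mul (a := C) (ENNReal.tendsto_ofReal h1)
      (Or.inr hCtop.ne)
    simpa using h2
  refine (tendsto_of_tendsto_of_tendsto_of_le_of_le' tendsto_const_nhds hlim
    (Eventually.of_forall fun _ => zero_le) ?_).limsup_eq
  filter_upwards [hev, self_mem_nhdsWithin] with δ hδ hpos
  have hp : 0 < δ ^ (1 - d) := Real.rpow_pos_of_pos hpos _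
  have hs : 0 < δ ^ (1 - s) := Real.rpow_pos_of_pos hpos _
  have hsd : 0 < δ ^ (s - d) := Real.rpow_pos_of_pos hpos _
  have hmul : δ ^ (1 - d) = δ ^ (s - d) * δ ^ (1 - s) := by
    rw [← Real.rpow_add hpos]; congr 1; ring
  have := (ENNReal.div_le_iff (ENNReal.ofReal_pos.2 hp).ne' ENNReal.ofReal_ne_top).1 hδ.le
  refine ENNReal.div_le_of_le_mul ?_
  rwa [mul_assoc, ← ENNReal.ofReal_mul hsd.le, ← hmul]

theorem lowerMinkowskiContent_pos_of_le {d s : ℝ} {U : Set ℝ}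
    (h : 0 < lowerMinkowskiContent d U) (hsd : s ≤ d) : 0 < lowerMinkowskiContent s U := by
  refine h.trans_le (liminf_le_liminf ?_)
  filter_upwards [self_mem_nhdsWithin, Ioo_mem_nhdsGT (zero_lt_one (α := ℝ))] with δ hpos h1
  exact ENNReal.div_le_div_left (ENNReal.ofReal_le_ofReal
    (Real.rpow_le_rpow_of_exponent_ge hpos h1.2.le (by linarith))) _

theorem hasMinkowskiDim_of_content {d : ℝ} {U : Set ℝ} (hd : 0 ≤ d)
    (hl : 0 < lowerMinkowskiContent d U) (hu : upperMinkowskiContent d U < ⊤) :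
    HasMinkowskiDim U d := by
  have hup : ∀ s, d < s → upperMinkowskiContent s U = 0 :=
    fun s hs => upperMinkowskiContent_eq_zero hu hs
  have hlo : ∀ s, d < s → lowerMinkowskiContent s U = 0 := fun s hs =>
    le_antisymm ((lowerMinkowskiContent_le_upper s U).trans (hup s hs).le) zero_le
  have key : ∀ s, lowerMinkowskiContent s U = 0 → d ≤ s := fun s hs => by
    by_contra! h
    exact (lowerMinkowskiContent_pos_of_le hl h.le).ne' hs
  constructor
  · refine csInf_eq_of_forall_ge_of_forall_gt_exists_lt
      ⟨d + 1, by linarith, hlo _ (by linarith)⟩ (fun s hs => key s hs.2) fun w hw => ?_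
    exact ⟨(d + w) / 2, ⟨by linarith, hlo _ (by linarith)⟩, by linarith⟩
  · refine csInf_eq_of_forall_ge_of_forall_gt_exists_lt
      ⟨d + 1, by linarith, hup _ (by linarith)⟩ (fun s hs => key s ?_) fun w hw => ?_
    · exact le_antisymm ((lowerMinkowskiContent_le_upper s U).trans hs.2.le) zero_le
    · exact ⟨(d + w) / 2, ⟨by linarith, hup _ (by linarith)⟩, by linarith⟩

theorem hasMinkowskiDim_zero {U : Set ℝ} (hup : ∀ s, 0 < s → upperMinkowskiContent s U = 0) :
    HasMinkowskiDim U 0 := by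
  have hlo : ∀ s, 0 < s → lowerMinkowskiContent s U = 0 := fun s hs =>
    le_antisymm ((lowerMinkowskiContent_le_upper s U).trans (hup s hs).le) zero_le
  constructor
  · refine csInf_eq_of_forall_ge_of_forall_gt_exists_lt
      ⟨1, by linarith, hlo _ (by linarith)⟩ (fun s hs => hs.1) fun w hw => ?_
    exact ⟨w / 2, ⟨by linarith, hlo _ (by linarith)⟩, by linarith⟩
  · refine csInf_eq_of_forall_ge_of_forall_gt_exists_lt
      ⟨1, by linarith, hup _ (by linarith)⟩ (fun s hs => hs.1) fun w hw => ?_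
    exact ⟨w / 2, ⟨by linarith, hup _ (by linarith)⟩, by linarith⟩

/-! ### Neighbourhoods of sequences decreasing to zero -/

/-- Nucleus and tail: the first `M` points are covered one by one, all later ones by a single
interval. Open balls of radius 2δ contain the closed δ-neighbourhood, whence the factor 4. -/
theorem volume_cthickening_range_le {r : ℕ → ℝ} (hr : Antitone r) (hr0 : ∀ l, 0 < r l)
    {δ : ℝ} (hδ : 0 < δ) (M : ℕ) :
    volume (Metric.cthickening δ (Set.range r)) ≤ ENNReal.ofReal ((4 * M + 4) * δ + r M) := by
  have hsub : Metric.cthickening δ (Set.range r) ⊆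
      (⋃ l ∈ Finset.range M, Metric.ball (r l) (2 * δ)) ∪ Set.Ioo (-(2 * δ)) (r M + 2 * δ) := by
    refine (Metric.cthickening_subset_thickening' (by linarith) (by linarith : δ < 2 * δ) _).trans
      fun x hx => ?_
    obtain ⟨_, ⟨l, rfl⟩, hl⟩ := Metric.mem_thickening_iff.1 hx
    rcases lt_or_ge l M with h | h
    · exact Or.inl (Set.mem_biUnion (Finset.mem_coe.2 (Finset.mem_range.2 h)) hl)
    · right
      rw [Real.dist_eq, abs_lt] at hl
      exact ⟨by linarith [hr0 l], by linarith [hr h]⟩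
  refine (measure_mono hsub).trans ((measure_union_le _ _).trans ?_)
  have h1 : volume (⋃ l ∈ Finset.range M, Metric.ball (r l) (2 * δ)) ≤
      ENNReal.ofReal (4 * M * δ) := by
    refine (measure_biUnion_finset_le _ _).trans ?_
    simp only [Real.volume_ball, Finset.sum_const, Finset.card_range]
    rw [← ENNReal.ofReal_nsmul]
    refine ENNReal.ofReal_le_ofReal (le_of_eq ?_)
    rw [nsmul_eq_mul]; ring
  refine (add_le_add_left h1 _).trans ?_
  rw [Real.volume_Ioo, ← ENNReal.ofReal_add (by positivity) (by linarith [hr0 M])]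
  exact ENNReal.ofReal_le_ofReal (le_of_eq (by ring))

/-- Linear growth of ρ^q makes 1/ρ at index M at most a multiple of M^(-1/q); the nucleus-tail bound
is then optimised over `M`. -/
theorem upperMinkowskiContent_lt_top_of_growth {ρ : ℕ → ℝ} (hmono : Monotone ρ)
    (hpos : ∀ l, 0 < ρ l) {q c : ℝ} (hq : 0 < q) (hc : 0 < c)
    (h : ∀ᶠ l in atTop, ρ l ^ q + c ≤ ρ (l + 1) ^ q) :
    upperMinkowskiContent (q / (q + 1)) (Set.range fun l => 1 / ρ l) < ⊤ := by
  obtain ⟨N, hN⟩ := eventually_atTop.1 h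
  have hlin : ∀ j : ℕ, c * j ≤ ρ (N + j) ^ q := by
    intro j
    induction j with
    | zero => simpa using (Real.rpow_pos_of_pos (hpos N) q).le
    | succ j ih =>
      have := hN (N + j) (by omega)
      push_cast
      rw [← add_assoc]
      linarith
  have hgrow : ∀ M : ℕ, 2 * N ≤ M → 1 ≤ M → 1 / ρ M ≤ (c / 2) ^ (-1 / q) * (M : ℝ) ^ (-1 / q) := by
    intro M hM hM1
    have hM1' : (1 : ℝ) ≤ M := by exact_mod_cast hM1
    have h1 : c / 2 * M ≤ ρ M ^ q := by
      have := hlin (M - N)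
      rw [show N + (M - N) = M by omega, Nat.cast_sub (by omega)] at this
      have h2 : (2 * N : ℝ) ≤ M := by exact_mod_cast hM
      nlinarith
    rw [← Real.mul_rpow (by positivity) (by positivity)]
    have h3 : 1 / ρ M = (ρ M ^ q) ^ (-1 / q) := by
      rw [← Real.rpow_mul (hpos M).le, mul_div_cancel₀ _ hq.ne', Real.rpow_neg_one, one_div]
    rw [h3]
    exact Real.rpow_le_rpow_of_nonpos (by positivity) h1
      (div_nonpos_of_nonpos_of_nonneg (by norm_num) hq.le)
  set d := q / (q + 1) with hd
  have hd0 : 0 < d := by positivity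
  have hd1 : d < 1 := by rw [hd, div_lt_one (by positivity)]; linarith
  have hanti : Antitone fun l => 1 / ρ l := fun a b hab =>
    one_div_le_one_div_of_le (hpos a) (hmono hab)
  -- The cut M = ⌈δ^(-d)⌉ balances the two parts: Mδ and M^(-1/q) are both of order δ^(1-d), since
  -- d/q = 1 - d.
  have hM : Tendsto (fun δ : ℝ => ⌈δ ^ (-d)⌉₊) (𝓝[>] 0) atTop :=
    tendsto_nat_ceil_atTop.comp (tendsto_rpow_neg_nhdsGT_zero (by linarith))
  -- From M ≤ δ^(-d) + 1, (4M+4)δ ≤ 4δ^(1-d) + 8δ ≤ 12δ^(1-d); the other summand bounds the tail.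
  refine upperMinkowskiContent_lt_top (C := 12 + (c / 2) ^ (-1 / q)) ?_
  filter_upwards [self_mem_nhdsWithin, Ioo_mem_nhdsGT (zero_lt_one (α := ℝ)),
    hM.eventually_ge_atTop (max 1 (2 * N))] with δ hδ h1 hMδ
  have hδ : 0 < δ := hδ
  refine (volume_cthickening_range_le hanti (fun l => one_div_pos.2 (hpos l)) hδ
    ⌈δ ^ (-d)⌉₊).trans (ENNReal.ofReal_le_ofReal ?_)
  have hg := hgrow _ ((le_max_right _ _).trans hMδ) ((le_max_left _ _).trans hMδ)
  have hp := Real.rpow_pos_of_pos hδ (-d)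
  have hceil := (Nat.ceil_lt_add_one hp.le).le
  have hle := Nat.le_ceil (δ ^ (-d))
  have hδd : δ ^ (-d) * δ = δ ^ (1 - d) := by
    nth_rewrite 2 [← Real.rpow_one δ]
    rw [← Real.rpow_add hδ]; congr 1; ring
  have hδ1 : δ ≤ δ ^ (1 - d) := by
    nth_rewrite 1 [← Real.rpow_one δ]
    exact Real.rpow_le_rpow_of_exponent_ge hδ h1.2.le (by linarith)
  have hpow : (⌈δ ^ (-d)⌉₊ : ℝ) ^ (-1 / q) ≤ δ ^ (1 - d) := by
    have h4 : (δ ^ (-d)) ^ (-1 / q) = δ ^ (1 - d) := by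
      rw [← Real.rpow_mul hδ.le]; congr 1; rw [hd]; field_simp; ring
    rw [← h4]
    exact Real.rpow_le_rpow_of_nonpos hp hle
      (div_nonpos_of_nonpos_of_nonneg (by norm_num) hq.le)
  have hK : 0 < (c / 2) ^ (-1 / q) := by positivity
  have h5 := mul_le_mul_of_nonneg_left hpow hK.le
  have h6 := mul_le_mul_of_nonneg_right hceil hδ.le
  nlinarith

/-- Below the threshold x₀ with C·x₀^p = δ all gaps are at most δ, so the δ-neighbourhood contains
the whole interval (0, x₀), of length comparable to δ^(1/p). -/
theorem lowerMinkowskiContent_pos_of_gap {r : ℕ → ℝ} (hr : Tendsto r atTop (𝓝 0))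
    (hpos : ∀ l, 0 < r l) {p C : ℝ} (hp : 0 < p) (hC : 0 < C)
    (h : ∀ᶠ l in atTop, r l - r (l + 1) ≤ C * r (l + 1) ^ p) :
    0 < lowerMinkowskiContent (1 - 1 / p) (Set.range r) := by
  obtain ⟨N, hN⟩ := eventually_atTop.1 h
  have hlim : Tendsto (fun δ : ℝ => (1 / C) ^ (1 / p) * δ ^ (1 / p)) (𝓝[>] 0) (𝓝 0) := by
    have := ((Real.continuousAt_rpow_const (0 : ℝ) (1 / p)
      (Or.inr (by positivity))).tendsto.const_mul ((1 / C) ^ (1 / p)))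
    rw [Real.zero_rpow (by positivity), mul_zero] at this
    exact this.mono_left nhdsWithin_le_nhds
  refine lowerMinkowskiContent_pos (c := (1 / C) ^ (1 / p)) (by positivity) ?_
  filter_upwards [self_mem_nhdsWithin, hlim.eventually_lt_const (hpos N)] with δ hδ hsmall
  have hδ : 0 < δ := hδ
  rw [sub_sub_cancel]
  set x₀ := (1 / C) ^ (1 / p) * δ ^ (1 / p) with hx₀
  have hx₀p : C * x₀ ^ p = δ := by
    rw [hx₀, ← Real.mul_rpow (by positivity) hδ.le, ← Real.rpow_mul (by positivity),
      one_div_mul_cancel hp.ne', Real.rpow_one]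
    field_simp
  have hsub : Set.Ioo 0 x₀ ⊆ Metric.cthickening δ (Set.range r) := by
    intro x hx
    have hex : ∃ j, r (N + j) < x := by
      obtain ⟨l, hl, hl'⟩ := ((hr.eventually_lt_const hx.1).and (eventually_ge_atTop N)).exists
      exact ⟨l - N, by rwa [show N + (l - N) = l by omega]⟩
    classical
    -- Taking the first index at which the sequence drops below `x` brackets `x` without any
    -- monotonicity.
    obtain ⟨j, hj, hmin⟩ : ∃ j, r (N + (j + 1)) < x ∧ x ≤ r (N + j) := by
      have h0 : Nat.find hex ≠ 0 := fun h0 => by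
        have := Nat.find_spec hex
        rw [h0, add_zero] at this
        linarith [hx.2]
      obtain ⟨j, hj⟩ := Nat.exists_eq_succ_of_ne_zero h0
      refine ⟨j, ?_, ?_⟩
      · have := Nat.find_spec hex
        rwa [hj] at this
      · exact not_lt.1 (Nat.find_min hex (m := j) (by omega))
    refine Metric.mem_cthickening_of_dist_le x (r (N + (j + 1))) δ _ ⟨_, rfl⟩ ?_
    rw [Real.dist_eq, abs_of_pos (by linarith)]
    have h1 := hN (N + j) (by omega)
    rw [add_assoc] at h1
    have h2 : r (N + (j + 1)) ^ p ≤ x₀ ^ p :=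
      Real.rpow_le_rpow (hpos _).le (by linarith [hx.2]) hp.le
    nlinarith [mul_le_mul_of_nonneg_left h2 hC.le]
  refine le_trans ?_ (measure_mono hsub)
  rw [Real.volume_Ioo, sub_zero]

/-- The reciprocals of a sequence growing at least geometrically have Minkowski dimension zero. -/
theorem hasMinkowskiDim_zero_of_geometric {ρ : ℕ → ℝ} (hmono : Monotone ρ) (hpos : ∀ l, 0 < ρ l)
    {lam : ℝ} (hlam : 1 < lam) (h : ∀ᶠ l in atTop, lam * ρ l ≤ ρ (l + 1)) :
    HasMinkowskiDim (Set.range fun l => 1 / ρ l) 0 := by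
  refine hasMinkowskiDim_zero fun s hs => ?_
  have hq := half_pos hs
  have h1 : 1 < lam ^ (s / 2) := Real.one_lt_rpow hlam hq
  have h0 := Real.rpow_pos_of_pos (hpos 0) (s / 2)
  -- Geometric growth makes every positive power of ρ grow at least linearly; q = s/2 gives a
  -- critical exponent q/(q+1) < s.
  refine upperMinkowskiContent_eq_zero (d := s / 2 / (s / 2 + 1))
    (upperMinkowskiContent_lt_top_of_growth hmono hpos hq
      (c := (lam ^ (s / 2) - 1) * ρ 0 ^ (s / 2)) (mul_pos (by linarith) h0) ?_) ?_
  · filter_upwards [h] with l hl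
    have h2 := Real.rpow_le_rpow (mul_pos (by linarith) (hpos l)).le hl hq.le
    rw [Real.mul_rpow (by linarith) (hpos l).le] at h2
    have h3 := Real.rpow_le_rpow (hpos 0).le (hmono (Nat.zero_le l)) hq.le
    nlinarith
  · rw [div_lt_iff₀ (by positivity)]; nlinarith

/-- If `ρ` tends to infinity with increments comparable to `ρ ^ (1 - q)`, then its reciprocals
form a Minkowski nondegenerate set of dimension `q / (q + 1)`. -/
theorem minkowski_of_power_growth {ρ : ℕ → ℝ} (hmono : Monotone ρ) (hpos : ∀ l, 0 < ρ l)
    (hlim : Tendsto ρ atTop atTop) {q : ℕ} (hq : 1 ≤ q) {c C : ℝ} (hc : 0 < c)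
    (h : ∀ᶠ l in atTop, c ≤ (ρ (l + 1) - ρ l) * ρ l ^ (q - 1) ∧
      (ρ (l + 1) - ρ l) * ρ l ^ (q - 1) ≤ C) :
    MinkowskiNondegenerate (Set.range fun l => 1 / ρ l) ∧
      HasMinkowskiDim (Set.range fun l => 1 / ρ l) ((q : ℝ) / (q + 1)) := by
  obtain ⟨m, rfl⟩ : ∃ m, q = m + 1 := ⟨q - 1, by omega⟩
  simp only [Nat.add_sub_cancel] at h
  have hC : 0 < C := by
    obtain ⟨l, hl⟩ := h.exists
    linarith
  have hup : upperMinkowskiContent (((m + 1 : ℕ) : ℝ) / ((m + 1 : ℕ) + 1))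
      (Set.range fun l => 1 / ρ l) < ⊤ := by
    refine upperMinkowskiContent_lt_top_of_growth hmono hpos (by positivity) hc ?_
    filter_upwards [h] with l hl
    have h1 : ρ l ^ m ≤ ρ (l + 1) ^ m :=
      pow_le_pow_left₀ (hpos l).le (hmono (Nat.le_succ l)) m
    rw [Real.rpow_natCast, Real.rpow_natCast, pow_succ, pow_succ]
    nlinarith [hpos (l + 1), hl.1]
  have hlo : 0 < lowerMinkowskiContent (((m + 1 : ℕ) : ℝ) / ((m + 1 : ℕ) + 1))
      (Set.range fun l => 1 / ρ l) := by
    -- Here p = q + 1 = m + 2. The increments are eventually at most `C` with ρ ≥ 1, so consecutive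
    -- terms have ratio at most 1 + C; this costs the factor (1 + C)^(m+1).
    have := lowerMinkowskiContent_pos_of_gap (r := fun l => 1 / ρ l) (p := (m + 2 : ℕ))
      (C := C * (1 + C) ^ (m + 1))
      (hlim.inv_tendsto_atTop.congr fun l => (one_div _).symm)
      (fun l => one_div_pos.2 (hpos l)) (by positivity) (by positivity) ?_
    · have e : ((m + 1 : ℕ) : ℝ) / ((m + 1 : ℕ) + 1) = 1 - 1 / ((m + 2 : ℕ) : ℝ) := by
        push_cast
        field_simp
        ring
      rwa [e]
    · filter_upwards [h, hlim.eventually_ge_atTop 1] with l hl h1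
      have hl0 := hpos l
      have hl1 := hpos (l + 1)
      have hle := hmono (Nat.le_succ l)
      have hρ1 : 1 ≤ ρ l ^ m := one_le_pow₀ h1
      have hd : ρ (l + 1) - ρ l ≤ C := by
        have : 0 ≤ ρ (l + 1) - ρ l := by simpa using hle
        nlinarith [hl.2]
      have hratio : ρ (l + 1) ≤ (1 + C) * ρ l := by nlinarith
      have hpow := pow_le_pow_left₀ hl1.le hratio (m + 1)
      rw [Real.rpow_natCast, div_sub_div _ _ hl0.ne' hl1.ne', one_div, inv_pow,
        ← div_eq_mul_inv, div_le_div_iff₀ (by positivity) (by positivity)]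
      rw [mul_pow] at hpow
      have e1 : (1 * ρ (l + 1) - ρ l * 1) * ρ (l + 1) ^ (m + 2) =
        (ρ (l + 1) - ρ l) * ρ (l + 1) * ρ (l + 1) ^ (m + 1) := by ring
      rw [e1]
      have h0 : 0 ≤ (ρ (l + 1) - ρ l) * ρ (l + 1) :=
        mul_nonneg (by simpa using hle) hl1.le
      refine (mul_le_mul_of_nonneg_left hpow h0).trans ?_
      have e2 : (ρ (l + 1) - ρ l) * ρ (l + 1) * ((1 + C) ^ (m + 1) * ρ l ^ (m + 1)) =
        ((ρ (l + 1) - ρ l) * ρ l ^ m) * ((1 + C) ^ (m + 1) * (ρ l * ρ (l + 1))) := by ring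
      rw [e2, mul_assoc C]
      exact mul_le_mul_of_nonneg_right hl.2 (by positivity)
  exact ⟨⟨_, by positivity, hlo, lowerMinkowskiContent_le_upper _ _, hup⟩,
    hasMinkowskiDim_of_content (by positivity) hlo hup⟩

/-! ### Monotone divergence of orbits -/

/-- By the intermediate value theorem J₂ - J₁ keeps its eventual sign on all of (y*, ∞), so T(y) > y
there. A finite limit of the orbit would satisfy J₁ = J₂ by continuity, which is excluded. -/
theorem orbitTendsToInfinity_of_lt {J₁ J₂ T : ℝ → ℝ} {ystar y₀ : ℝ} (hystar : 0 < ystar)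
    (hy₀ : ystar < y₀) (hJ₁ : StrictMonoOn J₁ (Set.Ioi 0)) (hc₁ : ContinuousOn J₁ (Set.Ioi 0))
    (hc₂ : ContinuousOn J₂ (Set.Ioi 0)) (hT : ∀ y, 0 < y → 0 < T y ∧ J₁ (T y) = J₂ y)
    (hne : ∀ y, ystar < y → J₁ y ≠ J₂ y) (hev : ∀ᶠ y in atTop, J₁ y < J₂ y) :
    (∀ l, 0 < T^[l] y₀) ∧ OrbitTendsToInfinity T y₀ := by
  have hlt : ∀ y, ystar < y → J₁ y < J₂ y := by
    intro y hy
    by_contra! hle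
    obtain ⟨Y, hY, hyY⟩ := (hev.and (eventually_ge_atTop y)).exists
    have hsub : Set.Icc y Y ⊆ Set.Ioi 0 := fun x hx => hystar.trans (hy.trans_le hx.1)
    obtain ⟨x, hx, hx0⟩ := intermediate_value_Icc hyY ((hc₂.sub hc₁).mono hsub)
      (show (0 : ℝ) ∈ Set.Icc (J₂ y - J₁ y) (J₂ Y - J₁ Y) from
        ⟨by linarith, by linarith⟩)
    exact hne x (hy.trans_le hx.1) (sub_eq_zero.1 hx0).symm
  have hTgt : ∀ y, ystar < y → y < T y := fun y hy => by
    have hy0 := hystar.trans hy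
    refine (hJ₁.lt_iff_lt (Set.mem_Ioi.2 hy0) (hT y hy0).1).1 ?_
    rw [(hT y hy0).2]
    exact hlt y hy
  have horb : ∀ l, ystar < T^[l] y₀ := by
    intro l
    induction l with
    | zero => exact hy₀
    | succ l ih =>
      rw [Function.iterate_succ_apply']
      exact ih.trans (hTgt _ ih)
  have hmono : StrictMono fun l : ℕ => T^[l] y₀ := strictMono_nat_of_lt_succ fun l => by
    rw [Function.iterate_succ_apply']
    exact hTgt _ (horb l)
  refine ⟨fun l => hystar.trans (horb l), hmono, ?_⟩
  rcases tendsto_atTop_of_monotone hmono.monotone with h | ⟨L, hL⟩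
  · exact h
  exfalso
  have hyL : y₀ ≤ L := hmono.monotone.ge_of_tendsto hL 0
  have hL0 : 0 < L := hystar.trans (hy₀.trans_le hyL)
  have hnhds := Ioi_mem_nhds hL0
  have h1 := ((hc₁.continuousAt hnhds).tendsto.comp (hL.comp (tendsto_add_atTop_nat 1)))
  have h2 := (hc₂.continuousAt hnhds).tendsto.comp hL
  refine hne L (hy₀.trans_le hyL) (tendsto_nhds_unique (h1.congr fun l => ?_) h2)
  simp only [Function.comp_apply, Function.iterate_succ_apply']
  exact (hT _ (hystar.trans (horb l))).2

/-! ### Asymptotics and primitives of polynomials -/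

theorem tendsto_eval_div_pow {α : Type*} {l : Filter α} {u ρ : α → ℝ} {t : ℝ}
    (hρ : Tendsto ρ l atTop) (hu : Tendsto (fun y => u y / ρ y) l (𝓝 t)) {p : ℝ[X]} {m : ℕ}
    (hp : p.natDegree ≤ m) :
    Tendsto (fun y => p.eval (u y) / ρ y ^ m) l (𝓝 (p.coeff m * t ^ m)) := by
  have hterm : ∀ i ∈ Finset.range (m + 1), Tendsto
      (fun y => p.coeff i * (u y / ρ y) ^ i * ((ρ y)⁻¹) ^ (m - i)) l
      (𝓝 (p.coeff i * t ^ i * 0 ^ (m - i))) := fun i _ =>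
    ((hu.pow i).const_mul _).mul (hρ.inv_tendsto_atTop.pow _)
  have hsum := tendsto_finsetSum _ hterm
  have hval : ∑ i ∈ Finset.range (m + 1), p.coeff i * t ^ i * 0 ^ (m - i) =
      p.coeff m * t ^ m := by
    rw [Finset.sum_eq_single_of_mem m (by simp)]
    · simp
    · intro i hi him
      rw [Finset.mem_range] at hi
      rw [zero_pow (by omega), mul_zero]
  rw [hval] at hsum
  refine hsum.congr' ?_
  filter_upwards [hρ.eventually_gt_atTop 0] with y hy
  rw [eval_eq_sum_range' (Nat.lt_succ_of_le hp), Finset.sum_div]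
  refine Finset.sum_congr rfl fun i hi => ?_
  rw [Finset.mem_range] at hi
  have : ρ y ^ m = ρ y ^ i * ρ y ^ (m - i) := by rw [← pow_add]; congr 1; omega
  rw [this, div_pow, inv_pow]
  field_simp

/-- Cauchy's mean value theorem, with P' ≠ 0 cancelled. It trades differences of `R` for differences
of `P`, whose values at inverse points are known exactly. -/
theorem exists_eval_sub_eval_eq {R Q P : ℝ[X]} (hR : derivative R = Q * derivative P)
    (hP : ∀ x, 0 < x → 0 < (derivative P).eval x) {u v : ℝ} (hu : 0 < u) (hv : 0 < v) :
    ∃ ξ ∈ Set.uIcc u v, R.eval v - R.eval u = Q.eval ξ * (P.eval v - P.eval u) := by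
  have main : ∀ a b : ℝ, 0 < a → a < b →
      ∃ ξ ∈ Set.Icc a b, R.eval b - R.eval a = Q.eval ξ * (P.eval b - P.eval a) := by
    intro a b ha hab
    obtain ⟨ξ, hξ, h⟩ := exists_ratio_hasDerivAt_eq_ratio_slope (fun x => R.eval x) _ hab
      R.continuous.continuousOn (fun x _ => R.hasDerivAt x) (fun x => P.eval x) _
      P.continuous.continuousOn (fun x _ => P.hasDerivAt x)
    refine ⟨ξ, Set.Ioo_subset_Icc_self hξ, ?_⟩
    have hpos := hP ξ (ha.trans hξ.1)
    rw [hR, eval_mul] at h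
    refine mul_right_cancel₀ hpos.ne' ?_
    linarith
  rcases lt_trichotomy u v with h | h | h
  · rw [Set.uIcc_of_le h.le]
    exact main u v hu h
  · exact ⟨u, Set.left_mem_uIcc, by simp [h]⟩
  · obtain ⟨ξ, hξ, h'⟩ := main v u hv h
    rw [Set.uIcc_of_ge h.le]
    exact ⟨ξ, hξ, by linarith⟩

theorem tendsto_div_of_mem_uIcc {α : Type*} {l : Filter α} {u v ξ ρ : α → ℝ} {t : ℝ}
    (hρ : ∀ᶠ y in l, 0 < ρ y) (hu : Tendsto (fun y => u y / ρ y) l (𝓝 t))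
    (hv : Tendsto (fun y => v y / ρ y) l (𝓝 t)) (hξ : ∀ᶠ y in l, ξ y ∈ Set.uIcc (u y) (v y)) :
    Tendsto (fun y => ξ y / ρ y) l (𝓝 t) := by
  refine tendsto_of_tendsto_of_tendsto_of_le_of_le' (g := fun y => min (u y / ρ y) (v y / ρ y))
    (h := fun y => max (u y / ρ y) (v y / ρ y))
    (by simpa using hu.min hv) (by simpa using hu.max hv) ?_ ?_
  · filter_upwards [hρ, hξ] with y hy h
    rw [min_div_div_right hy.le]
    exact div_le_div_of_nonneg_right h.1 hy.le
  · filter_upwards [hρ, hξ] with y hy h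
    rw [max_div_div_right hy.le]
    exact div_le_div_of_nonneg_right h.2 hy.le

theorem tendsto_of_pow {α : Type*} {l : Filter α} {u : α → ℝ} {t : ℝ} {m : ℕ} (hm : m ≠ 0)
    (hu : ∀ᶠ y in l, 0 ≤ u y) (h : Tendsto (fun y => u y ^ m) l (𝓝 t)) :
    Tendsto u l (𝓝 (t ^ ((m : ℝ)⁻¹))) := by
  refine (h.rpow_const (p := (m : ℝ)⁻¹) (Or.inr (by positivity))).congr' ?_
  filter_upwards [hu] with y hy
  exact Real.pow_rpow_inv_natCast hy hm

/-- The formal antiderivative of a real polynomial that vanishes at the origin. -/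
noncomputable def antideriv (p : ℝ[X]) : ℝ[X] :=
  ∑ i ∈ Finset.range (p.natDegree + 1), C (p.coeff i / (i + 1)) * X ^ (i + 1)

theorem coeff_antideriv_succ (p : ℝ[X]) (j : ℕ) :
    (antideriv p).coeff (j + 1) = p.coeff j / (j + 1) := by
  simp only [antideriv, finsetSum_coeff, coeff_C_mul, coeff_X_pow, Nat.add_right_cancel_iff,
    mul_ite, mul_one, mul_zero, Finset.sum_ite_eq, Finset.mem_range]
  split_ifs with h
  · rfl
  · rw [coeff_eq_zero_of_natDegree_lt (by omega), zero_div]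

theorem coeff_antideriv_zero (p : ℝ[X]) : (antideriv p).coeff 0 = 0 := by
  simp [antideriv, finsetSum_coeff, coeff_X_pow]

theorem derivative_antideriv (p : ℝ[X]) : derivative (antideriv p) = p := by
  ext j
  rw [coeff_derivative, coeff_antideriv_succ]
  field_simp

theorem eval_antideriv_zero (p : ℝ[X]) : (antideriv p).eval 0 = 0 := by
  rw [← coeff_zero_eq_eval_zero, coeff_antideriv_zero]

theorem antideriv_sub (p q : ℝ[X]) : antideriv (p - q) = antideriv p - antideriv q := by
  ext j
  cases j with
  | zero => simp [coeff_antideriv_zero]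
  | succ j => simp [coeff_antideriv_succ, sub_div]

theorem natDegree_antideriv_le {p : ℝ[X]} {m : ℕ} (h : p.natDegree ≤ m) :
    (antideriv p).natDegree ≤ m + 1 := by
  rw [natDegree_le_iff_coeff_eq_zero] at h ⊢
  intro N hN
  obtain ⟨j, rfl⟩ : ∃ j, N = j + 1 := ⟨N - 1, by omega⟩
  rw [coeff_antideriv_succ, h j (by omega), zero_div]

theorem tendsto_eval_atTop {p : ℝ[X]} {m : ℕ} (hm : m ≠ 0) (hp : p.natDegree ≤ m)
    (hc : 0 < p.coeff m) : Tendsto (fun x => p.eval x) atTop atTop := by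
  have h1 : Tendsto (fun x : ℝ => x / x) atTop (𝓝 1) := by
    refine tendsto_const_nhds.congr' ?_
    filter_upwards [eventually_gt_atTop 0] with x hx
    rw [div_self hx.ne']
  have h := tendsto_eval_div_pow tendsto_id h1 hp
  rw [one_pow, mul_one] at h
  refine (h.pos_mul_atTop hc (tendsto_pow_atTop hm)).congr' ?_
  filter_upwards [eventually_gt_atTop 0] with x hx
  simp only [id]
  field_simp

theorem exists_eval_eq {p : ℝ[X]} (h0 : p.eval 0 = 0)
    (hp : Tendsto (fun x => p.eval x) atTop atTop) {v : ℝ} (hv : 0 < v) :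
    ∃ x, 0 < x ∧ p.eval x = v := by
  obtain ⟨b, hb, hb0⟩ := ((hp.eventually_ge_atTop v).and (eventually_ge_atTop 0)).exists
  obtain ⟨x, hx, hxv⟩ := intermediate_value_Icc hb0 p.continuous.continuousOn
    (show v ∈ Set.Icc (p.eval 0) (p.eval b) from ⟨by linarith, hb⟩)
  refine ⟨x, lt_of_le_of_ne hx.1 fun h => ?_, hxv⟩
  rw [← h] at hxv
  simp only [h0] at hxv
  linarith

theorem strictMonoOn_eval {p : ℝ[X]} (h : ∀ x, 0 < x → 0 < (derivative p).eval x) :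
    StrictMonoOn (fun x => p.eval x) (Set.Ici 0) := by
  refine strictMonoOn_of_deriv_pos (convex_Ici 0) p.continuous.continuousOn fun x hx => ?_
  rw [interior_Ici] at hx
  rw [Polynomial.deriv]
  exact h x hx

/-! ### Admissible branches, their energies and inverses -/

/-- Monic polynomials of degree `n + 1` with a critical zero at the origin that are strictly
increasing on the positive half-line. -/
structure IsAdmissible (n : ℕ) (P : ℝ[X]) : Prop where
  natDegree_le : P.natDegree ≤ n + 1
  coeff_succ : P.coeff (n + 1) = 1
  coeff_zero : P.coeff 0 = 0
  coeff_one : P.coeff 1 = 0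
  deriv_pos : ∀ x, 0 < x → 0 < (derivative P).eval x

/-- The polynomial `P' / X`, when `P'` vanishes at the origin. -/
noncomputable def slope (P : ℝ[X]) : ℝ[X] := (derivative P).divX

/-- The integral of `P' ^ 2 / X` from the origin. -/
noncomputable def energy (P : ℝ[X]) : ℝ[X] := antideriv (X * slope P ^ 2)

/-- `w` is the inverse of `P` on the positive half-line. -/
def IsPosInverse (P : ℝ[X]) (w : ℝ → ℝ) : Prop := ∀ y, 0 < y → 0 < w y ∧ P.eval (w y) = y

/-- The function `y ↦ y ^ (1 / (n + 1))`. -/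
noncomputable def rho (n : ℕ) (y : ℝ) : ℝ := y ^ ((1 : ℝ) / ((n : ℝ) + 1))

theorem rho_pos (n : ℕ) {y : ℝ} (hy : 0 < y) : 0 < rho n y := Real.rpow_pos_of_pos hy _

theorem rho_pow (n : ℕ) {y : ℝ} (hy : 0 < y) : rho n y ^ (n + 1) = y := by
  have := Real.rpow_inv_natCast_pow hy.le (Nat.succ_ne_zero n)
  rw [rho, one_div]
  exact_mod_cast this

theorem tendsto_rho (n : ℕ) : Tendsto (rho n) atTop atTop :=
  tendsto_rpow_atTop (by positivity)

theorem coeff_slope (P : ℝ[X]) (j : ℕ) : (slope P).coeff j = P.coeff (j + 2) * (j + 2) := by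
  rw [slope, coeff_divX, coeff_derivative]
  push_cast
  ring

theorem natDegree_slope_le {P : ℝ[X]} {m : ℕ} (h : P.natDegree ≤ m + 2) :
    (slope P).natDegree ≤ m := by
  rw [natDegree_le_iff_coeff_eq_zero] at h ⊢
  intro N hN
  rw [coeff_slope, h _ (by omega), zero_mul]

theorem slope_sub (P₁ P₂ : ℝ[X]) : slope (P₁ - P₂) = slope P₁ - slope P₂ := by
  ext j
  simp [coeff_slope, sub_mul]

theorem X_mul_slope {P : ℝ[X]} (h : P.coeff 1 = 0) : X * slope P = derivative P := by
  have := divX_mul_X_add (derivative P)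
  rw [coeff_derivative, h] at this
  rw [slope, mul_comm]
  simpa using this

theorem eval_energy_zero (P : ℝ[X]) : (energy P).eval 0 = 0 := eval_antideriv_zero _

namespace IsAdmissible

variable {n : ℕ} {P : ℝ[X]}

theorem derivative_energy (h : IsAdmissible n P) :
    derivative (energy P) = slope P * derivative P := by
  rw [energy, derivative_antideriv, ← X_mul_slope h.coeff_one]
  ring

theorem eval_slope_pos (h : IsAdmissible n P) {x : ℝ} (hx : 0 < x) : 0 < (slope P).eval x := by
  have := h.deriv_pos x hx
  rw [← X_mul_slope h.coeff_one, eval_mul, eval_X] at this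
  exact pos_of_mul_pos_right this hx.le

theorem strictMonoOn_energy (h : IsAdmissible n P) :
    StrictMonoOn (fun x => (energy P).eval x) (Set.Ici 0) :=
  strictMonoOn_eval fun x hx => by
    rw [h.derivative_energy, eval_mul]
    exact mul_pos (h.eval_slope_pos hx) (h.deriv_pos x hx)

theorem eval_zero (h : IsAdmissible n P) : P.eval 0 = 0 := by
  rw [← coeff_zero_eq_eval_zero, h.coeff_zero]

theorem exists_eval_eq (h : IsAdmissible n P) {v : ℝ} (hv : 0 < v) :
    ∃ x, 0 < x ∧ P.eval x = v :=
  PWSLienard.exists_eval_eq h.eval_zero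
    (tendsto_eval_atTop (Nat.succ_ne_zero n) h.natDegree_le (by rw [h.coeff_succ]; norm_num)) hv

theorem natDegree_slope_le (hn : 1 ≤ n) (h : IsAdmissible n P) :
    (slope P).natDegree ≤ n - 1 :=
  PWSLienard.natDegree_slope_le (h.natDegree_le.trans (by omega))

theorem coeff_slope (hn : 1 ≤ n) (h : IsAdmissible n P) :
    (slope P).coeff (n - 1) = n + 1 := by
  rw [PWSLienard.coeff_slope, show n - 1 + 2 = n + 1 by omega, h.coeff_succ, Nat.cast_sub hn]
  push_cast
  ring

theorem natDegree_energy_le (hn : 1 ≤ n) (h : IsAdmissible n P) :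
    (energy P).natDegree ≤ 2 * n := by
  have h1 : (X * slope P ^ 2).natDegree ≤ 2 * n - 1 := by
    refine natDegree_mul_le.trans ?_
    have := natDegree_pow_le_of_le 2 (h.natDegree_slope_le hn)
    have := natDegree_X_le (R := ℝ)
    omega
  have := natDegree_antideriv_le h1
  rw [energy]
  omega

/-- P'/x has top term (n+1)x^(n-1), so the integrand P'²/x has top term (n+1)²x^(2n-1). The value
does not depend on the lower coefficients of `P`. -/
theorem coeff_energy (hn : 1 ≤ n) (h : IsAdmissible n P) :
    (energy P).coeff (2 * n) = (n + 1) ^ 2 / (2 * n) := by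
  obtain ⟨m, rfl⟩ : ∃ m, n = m + 1 := ⟨n - 1, by omega⟩
  have h1 := h.natDegree_slope_le hn
  have h2 := h.coeff_slope hn
  simp only [Nat.add_sub_cancel] at h1 h2
  rw [energy, show 2 * (m + 1) = (2 * m + 1) + 1 by ring, coeff_antideriv_succ, coeff_X_mul,
    coeff_pow_of_natDegree_le h1, h2]
  push_cast
  congr 1
  ring

theorem coeff_energy_pos (hn : 1 ≤ n) (h : IsAdmissible n P) :
    0 < (energy P).coeff (2 * n) := by
  have : (1 : ℝ) ≤ n := by exact_mod_cast hn
  rw [h.coeff_energy hn]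
  positivity

theorem exists_energy_eq (hn : 1 ≤ n) (h : IsAdmissible n P) {v : ℝ} (hv : 0 < v) :
    ∃ x, 0 < x ∧ (energy P).eval x = v :=
  PWSLienard.exists_eval_eq (eval_energy_zero P)
    (tendsto_eval_atTop (by omega) (h.natDegree_energy_le hn) (h.coeff_energy_pos hn)) hv

theorem eval_pos (h : IsAdmissible n P) {x : ℝ} (hx : 0 < x) : 0 < P.eval x := by
  have := strictMonoOn_eval h.deriv_pos Set.self_mem_Ici (Set.mem_Ici.2 hx.le) hx
  simpa only [h.eval_zero] using this

theorem energy_pos (h : IsAdmissible n P) {x : ℝ} (hx : 0 < x) : 0 < (energy P).eval x := by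
  have := h.strictMonoOn_energy Set.self_mem_Ici (Set.mem_Ici.2 hx.le) hx
  simpa only [eval_energy_zero] using this

variable {w : ℝ → ℝ}

theorem inverse_eval (h : IsAdmissible n P) (hw : IsPosInverse P w) {x : ℝ} (hx : 0 < x) :
    w (P.eval x) = x := by
  have := hw _ (h.eval_pos hx)
  exact (strictMonoOn_eval h.deriv_pos).injOn (Set.mem_Ici.2 this.1.le) (Set.mem_Ici.2 hx.le)
    this.2

theorem strictMonoOn_inverse (h : IsAdmissible n P) (hw : IsPosInverse P w) :
    StrictMonoOn w (Set.Ioi 0) := fun y hy z hz hyz => by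
  refine ((strictMonoOn_eval h.deriv_pos).lt_iff_lt (Set.mem_Ici.2 (hw y hy).1.le)
    (Set.mem_Ici.2 (hw z hz).1.le)).1 ?_
  simpa only [(hw y hy).2, (hw z hz).2] using hyz

theorem continuousOn_inverse (h : IsAdmissible n P) (hw : IsPosInverse P w) :
    ContinuousOn w (Set.Ioi 0) := fun y hy => by
  refine ((h.strictMonoOn_inverse hw).continuousAt_of_image_mem_nhds (Ioi_mem_nhds hy)
    (Filter.mem_of_superset (Ioi_mem_nhds (hw y hy).1) fun x hx => ?_)).continuousWithinAt
  exact ⟨P.eval x, h.eval_pos hx, h.inverse_eval hw hx⟩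

theorem tendsto_inverse (h : IsAdmissible n P) (hw : IsPosInverse P w) :
    Tendsto w atTop atTop := by
  refine tendsto_atTop.2 fun b => ?_
  have hb : 0 < max b 1 := lt_max_of_lt_right one_pos
  filter_upwards [eventually_gt_atTop (P.eval (max b 1))] with y hy
  have := h.strictMonoOn_inverse hw (h.eval_pos hb) ((h.eval_pos hb).trans hy) hy
  rw [h.inverse_eval hw hb] at this
  exact (le_max_left _ _).trans this.le

/-- P(w) ~ w^(n+1), while P(w) = y = ρ^(n+1) exactly; taking (n+1)-th roots gives the limit. -/
theorem tendsto_inverse_div_rho (h : IsAdmissible n P) (hw : IsPosInverse P w) :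
    Tendsto (fun y => w y / rho n y) atTop (𝓝 1) := by
  have hlim := h.tendsto_inverse hw
  have h1 : Tendsto (fun y => w y / w y) atTop (𝓝 1) := by
    refine tendsto_const_nhds.congr' ?_
    filter_upwards [eventually_gt_atTop 0] with y hy
    rw [div_self (hw y hy).1.ne']
  have h2 := (tendsto_eval_div_pow hlim h1 h.natDegree_le).inv₀
    (by rw [h.coeff_succ]; norm_num)
  rw [h.coeff_succ, one_pow, one_mul, inv_one] at h2
  have h3 : Tendsto (fun y => (w y / rho n y) ^ (n + 1)) atTop (𝓝 1) := by
    refine h2.congr' ?_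
    filter_upwards [eventually_gt_atTop 0] with y hy
    rw [(hw y hy).2, inv_div, div_pow, rho_pow n hy]
  have h4 := tendsto_of_pow (Nat.succ_ne_zero n) ?_ h3
  · rwa [Real.one_rpow] at h4
  · filter_upwards [eventually_gt_atTop 0] with y hy
    exact (div_pos (hw y hy).1 (rho_pos n hy)).le

theorem tendsto_energy_div (hn : 1 ≤ n) (h : IsAdmissible n P) (hw : IsPosInverse P w) :
    Tendsto (fun y => (energy P).eval (w y) / rho n y ^ (2 * n)) atTop
      (𝓝 ((n + 1) ^ 2 / (2 * n))) := by
  have := tendsto_eval_div_pow (tendsto_rho n) (h.tendsto_inverse_div_rho hw)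
    (h.natDegree_energy_le hn)
  rwa [h.coeff_energy hn, one_pow, mul_one] at this

theorem strictMonoOn_integral (h : IsAdmissible n P) (hw : IsPosInverse P w) {a : ℝ}
    (ha : 0 < a) : StrictMonoOn (fun y => (energy P).eval (w y) / a) (Set.Ioi 0) :=
  fun y hy z hz hyz => div_lt_div_of_pos_right (h.strictMonoOn_energy
    (Set.mem_Ici.2 (hw y hy).1.le) (Set.mem_Ici.2 (hw z hz).1.le)
    (h.strictMonoOn_inverse hw hy hz hyz)) ha

theorem continuousOn_integral (h : IsAdmissible n P) (hw : IsPosInverse P w) (a : ℝ) :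
    ContinuousOn (fun y => (energy P).eval (w y) / a) (Set.Ioi 0) :=
  ((energy P).continuous.comp_continuousOn (h.continuousOn_inverse hw)).div_const a

end IsAdmissible

/-! ### Asymptotics of the slow relation and its orbits -/

/-- `T y` is the level at which the slow divergence integral of the first branch equals the one
of the second branch at level `y`. -/
def IsSlowRelation (P₁ P₂ : ℝ[X]) (w₁ w₂ : ℝ → ℝ) (a₁ a₂ : ℝ) (T : ℝ → ℝ) : Prop :=
  ∀ y, 0 < y → 0 < T y ∧ (energy P₁).eval (w₁ (T y)) / a₁ = (energy P₂).eval (w₂ y) / a₂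

section

variable {n : ℕ} {P₁ P₂ : ℝ[X]} {w₁ w₂ T : ℝ → ℝ} {a₁ a₂ : ℝ}

theorem tendsto_slowRelation (h₁ : IsAdmissible n P₁) (hw₁ : IsPosInverse P₁ w₁) (ha₁ : 0 < a₁)
    (hT : IsSlowRelation P₁ P₂ w₁ w₂ a₁ a₂ T)
    (hev : ∀ᶠ y in atTop, (energy P₁).eval (w₁ y) / a₁ < (energy P₂).eval (w₂ y) / a₂) :
    Tendsto T atTop atTop := by
  refine tendsto_atTop_mono' _ ?_ tendsto_id
  filter_upwards [hev, eventually_gt_atTop 0] with y hy hy0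
  rw [← (hT y hy0).2] at hy
  exact ((h₁.strictMonoOn_integral hw₁ ha₁).lt_iff_lt hy0 (hT y hy0).1).1 hy |>.le

/-- Both energies are asymptotic to the same multiple of ρ^(2n), so the defining equation forces
(ρ(Ty)/ρ(y))^(2n) → a₁/a₂. -/
theorem tendsto_slowRelation_div (hn : 1 ≤ n) (h₁ : IsAdmissible n P₁) (h₂ : IsAdmissible n P₂)
    (hw₁ : IsPosInverse P₁ w₁) (hw₂ : IsPosInverse P₂ w₂) (ha₁ : 0 < a₁) (ha₂ : 0 < a₂)
    (hT : IsSlowRelation P₁ P₂ w₁ w₂ a₁ a₂ T) (hlim : Tendsto T atTop atTop) :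
    Tendsto (fun y => rho n (T y) / rho n y) atTop
      (𝓝 ((a₁ / a₂) ^ ((((2 * n : ℕ) : ℝ))⁻¹))) := by
  have hn' : (1 : ℝ) ≤ n := by exact_mod_cast hn
  have hK : ((n : ℝ) + 1) ^ 2 / (2 * n) ≠ 0 := by positivity
  have e1 := ((h₁.tendsto_energy_div hn hw₁).comp hlim)
  have e2 := (h₂.tendsto_energy_div hn hw₂).const_mul (a₁ / a₂)
  have e3 := e2.div e1 hK
  rw [mul_div_assoc, div_self hK, mul_one] at e3
  refine tendsto_of_pow (by omega) ?_ (e3.congr' ?_)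
  · filter_upwards [eventually_gt_atTop 0] with y hy
    exact (div_pos (rho_pos n (hT y hy).1) (rho_pos n hy)).le
  · filter_upwards [eventually_gt_atTop 0] with y hy
    have hp := h₁.energy_pos (hw₁ _ (hT y hy).1).1
    have hρ := rho_pos n hy
    have hρ' := rho_pos n (hT y hy).1
    have heq : a₁ / a₂ * (energy P₂).eval (w₂ y) = (energy P₁).eval (w₁ (T y)) := by
      have := (hT y hy).2
      field_simp at this ⊢
      linarith
    simp only [Pi.div_apply, Function.comp_apply]
    rw [← mul_div_assoc, heq, div_pow]
    field_simp

theorem geometric_orbit (hn : 1 ≤ n) (h₁ : IsAdmissible n P₁) (h₂ : IsAdmissible n P₂)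
    (hw₁ : IsPosInverse P₁ w₁) (hw₂ : IsPosInverse P₂ w₂) (ha₂ : 0 < a₂) (ha : a₂ < a₁)
    (hT : IsSlowRelation P₁ P₂ w₁ w₂ a₁ a₂ T) {ystar y₀ : ℝ} (hystar : 0 < ystar)
    (hy₀ : ystar < y₀) (hne : ∀ y, ystar < y →
      (energy P₁).eval (w₁ y) / a₁ ≠ (energy P₂).eval (w₂ y) / a₂) :
    OrbitTendsToInfinity T y₀ ∧ HasMinkowskiDim (orbitAtInfinity n T y₀) 0 := by
  have ha₁ := ha₂.trans ha
  have hn' : (1 : ℝ) ≤ n := by exact_mod_cast hn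
  have hev : ∀ᶠ y in atTop,
      (energy P₁).eval (w₁ y) / a₁ < (energy P₂).eval (w₂ y) / a₂ := by
    have hlt : ((n : ℝ) + 1) ^ 2 / (2 * n) / a₁ < ((n : ℝ) + 1) ^ 2 / (2 * n) / a₂ :=
      div_lt_div_of_pos_left (by positivity) ha₂ ha
    filter_upwards [((h₁.tendsto_energy_div hn hw₁).div_const a₁).eventually_lt
      ((h₂.tendsto_energy_div hn hw₂).div_const a₂) hlt, eventually_gt_atTop 0] with y hy hy0
    rw [div_right_comm, div_right_comm _ _ a₂] at hy
    exact (div_lt_div_iff_of_pos_right (pow_pos (rho_pos n hy0) _)).1 hy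
  obtain ⟨hpos, horb⟩ := orbitTendsToInfinity_of_lt hystar hy₀ (h₁.strictMonoOn_integral hw₁ ha₁)
    (h₁.continuousOn_integral hw₁ a₁) (h₂.continuousOn_integral hw₂ a₂) hT hne hev
  refine ⟨horb, ?_⟩
  have hlim := tendsto_slowRelation h₁ hw₁ ha₁ hT hev
  have hratio := tendsto_slowRelation_div hn h₁ h₂ hw₁ hw₂ ha₁ ha₂ hT hlim
  have hone : 1 < (a₁ / a₂) ^ ((((2 * n : ℕ) : ℝ))⁻¹) :=
    Real.one_lt_rpow ((one_lt_div ha₂).2 ha) (by positivity)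
  obtain ⟨lam, hlam, hlam'⟩ := exists_between hone
  refine hasMinkowskiDim_zero_of_geometric (ρ := fun l => rho n (T^[l] y₀))
    (fun i j hij => ?_) (fun l => rho_pos n (hpos l)) hlam ?_
  · exact Real.rpow_le_rpow (hpos i).le (horb.1.monotone hij) (by positivity)
  · filter_upwards [horb.2.eventually (hratio.eventually_const_lt hlam')] with l hl
    rw [Function.iterate_succ_apply']
    exact ((lt_div_iff₀ (rho_pos n (hpos l))).1 hl).le

variable {k : ℕ}

/-- Split E₂(w₂) - E₁(w₁) as (E₂ - E₁)(w₂) minus (E₁(w₁) - E₁(w₂)). Both parts have order ρ^(n+k-1),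
and their coefficients 2k/(n+k-1) and 1, times (n+1)f, differ by the factor (1+k-n)/(n+k-1), which
vanishes exactly at k = n - 1. -/
theorem tendsto_energy_sub (hn : 1 ≤ n) (h₁ : IsAdmissible n P₁) (h₂ : IsAdmissible n P₂)
    (hw₁ : IsPosInverse P₁ w₁) (hw₂ : IsPosInverse P₂ w₂) (hk : 2 ≤ k)
    (hdeg : (P₂ - P₁).natDegree ≤ k) :
    Tendsto (fun y => ((energy P₂).eval (w₂ y) - (energy P₁).eval (w₁ y)) /
        rho n y ^ (n + k - 1)) atTop
      (𝓝 ((n + 1) * ((P₂ - P₁).coeff k * (1 + k - n)) / (n + k - 1))) := by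
  set f := P₂ - P₁ with hf
  have hn' : (1 : ℝ) ≤ n := by exact_mod_cast hn
  have hk' : (2 : ℝ) ≤ k := by exact_mod_cast hk
  have hρ := tendsto_rho n
  have t₁ := h₁.tendsto_inverse_div_rho hw₁
  have t₂ := h₂.tendsto_inverse_div_rho hw₂
  have hs : (slope f).natDegree ≤ k - 2 := natDegree_slope_le (by omega)
  have hss : (slope P₂ + slope P₁).natDegree ≤ n - 1 :=
    natDegree_add_le_of_degree_le (h₂.natDegree_slope_le hn) (h₁.natDegree_slope_le hn)
  -- Difference of squares: the factor P₂'/x - P₁'/x has degree at most k - 2, and the sum has top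
  -- coefficient 2(n+1).
  have hE : energy P₂ - energy P₁ = antideriv (X * (slope f * (slope P₂ + slope P₁))) := by
    rw [energy, energy, ← antideriv_sub, hf, slope_sub]
    congr 1
    ring
  have hEdeg : (energy P₂ - energy P₁).natDegree ≤ n + k - 1 := by
    have h3 : (X * (slope f * (slope P₂ + slope P₁))).natDegree ≤ n + k - 2 := by
      refine natDegree_mul_le.trans ?_
      have h4 := natDegree_mul_le_of_le hs hss
      have := natDegree_X_le (R := ℝ)
      omega
    have := natDegree_antideriv_le h3
    rw [hE]
    omega
  have hEcoeff : (energy P₂ - energy P₁).coeff (n + k - 1) =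
      2 * (n + 1) * (f.coeff k * k) / (n + k - 1) := by
    obtain ⟨m, rfl⟩ : ∃ m, n = m + 1 := ⟨n - 1, by omega⟩
    obtain ⟨j, rfl⟩ : ∃ j, k = j + 2 := ⟨k - 2, by omega⟩
    have c1 := h₁.coeff_slope hn
    have c2 := h₂.coeff_slope hn
    simp only [Nat.add_sub_cancel] at hs hss c1 c2
    rw [hE, show m + 1 + (j + 2) - 1 = (j + m + 1) + 1 by omega, coeff_antideriv_succ,
      coeff_X_mul, coeff_mul_add_eq_of_natDegree_le hs hss, coeff_add, c1, c2, coeff_slope]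
    push_cast
    congr 1 <;> ring
  -- Since P₁(w₁(y)) = y = P₂(w₂(y)), the increment of `P₁` from w₂ to w₁ equals (P₂ - P₁)(w₂).
  have hmvt : ∀ y, ∃ ξ, 0 < y → ξ ∈ Set.uIcc (w₂ y) (w₁ y) ∧
      (energy P₁).eval (w₁ y) - (energy P₁).eval (w₂ y) =
        (slope P₁).eval ξ * f.eval (w₂ y) := by
    intro y
    by_cases hy : 0 < y
    · obtain ⟨ξ, hξ, h⟩ := exists_eval_sub_eval_eq h₁.derivative_energy h₁.deriv_pos
        (hw₂ y hy).1 (hw₁ y hy).1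
      refine ⟨ξ, fun _ => ⟨hξ, ?_⟩⟩
      rw [h, hf, eval_sub, (hw₁ y hy).2, (hw₂ y hy).2]
    · exact ⟨0, fun h => absurd h hy⟩
  choose ξ hξ using hmvt
  have tξ : Tendsto (fun y => ξ y / rho n y) atTop (𝓝 1) := by
    refine tendsto_div_of_mem_uIcc ?_ t₂ t₁ ?_
    · filter_upwards [eventually_gt_atTop 0] with y hy using rho_pos n hy
    · filter_upwards [eventually_gt_atTop 0] with y hy using (hξ y hy).1
  have l1 := tendsto_eval_div_pow hρ t₂ hEdeg
  have l2 := tendsto_eval_div_pow hρ tξ (h₁.natDegree_slope_le hn)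
  have l3 := tendsto_eval_div_pow hρ t₂ hdeg
  rw [hEcoeff] at l1
  rw [h₁.coeff_slope hn] at l2
  have l4 := l1.sub (l2.mul l3)
  have hval : 2 * ((n : ℝ) + 1) * (f.coeff k * k) / (n + k - 1) * 1 ^ (n + k - 1) -
      ((n : ℝ) + 1) * 1 ^ (n - 1) * (f.coeff k * 1 ^ k) =
      (n + 1) * (f.coeff k * (1 + k - n)) / (n + k - 1) := by
    have : (n : ℝ) + k - 1 ≠ 0 := by linarith
    simp only [one_pow, mul_one]
    field_simp
    ring
  rw [hval] at l4
  refine l4.congr' ?_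
  filter_upwards [eventually_gt_atTop 0] with y hy
  have hpow : rho n y ^ (n + k - 1) = rho n y ^ (n - 1) * rho n y ^ k := by
    rw [← pow_add]; congr 1; omega
  rw [div_mul_div_comm, ← hpow, ← sub_div, ← (hξ y hy).2, eval_sub]
  congr 1
  ring

/-- The energy gap equals E₁(w₁(Ty)) - E₁(w₁(y)). Two mean values turn it into (P₁'/x)(ξ) · (n+1)η^n
· (ρ(Ty) - ρ(y)), with ξ and η asymptotic to ρ; dividing leaves the power ρ^(k-n). -/
theorem tendsto_rho_increment (hn : 1 ≤ n) (h₁ : IsAdmissible n P₁) (h₂ : IsAdmissible n P₂)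
    (hw₁ : IsPosInverse P₁ w₁) (hw₂ : IsPosInverse P₂ w₂) {a : ℝ} (ha : 0 < a)
    (hT : IsSlowRelation P₁ P₂ w₁ w₂ a a T) (hlim : Tendsto T atTop atTop) (hk : 2 ≤ k)
    (hkn : k ≤ n) (hdeg : (P₂ - P₁).natDegree ≤ k) :
    Tendsto (fun y => (rho n (T y) - rho n y) * rho n y ^ (n - k)) atTop
      (𝓝 ((n + 1) * ((P₂ - P₁).coeff k * (1 + k - n)) / (n + k - 1) / (n + 1) ^ 2)) := by
  have hρ := tendsto_rho n
  have hρpos : ∀ᶠ y in atTop, 0 < rho n y := by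
    filter_upwards [eventually_gt_atTop 0] with y hy using rho_pos n hy
  have tT := tendsto_slowRelation_div hn h₁ h₂ hw₁ hw₂ ha ha hT hlim
  rw [div_self ha.ne', Real.one_rpow] at tT
  have tρ : Tendsto (fun y => rho n y / rho n y) atTop (𝓝 1) := by
    refine tendsto_const_nhds.congr' ?_
    filter_upwards [hρpos] with y hy
    rw [div_self hy.ne']
  have t₁ := h₁.tendsto_inverse_div_rho hw₁
  have t₁T : Tendsto (fun y => w₁ (T y) / rho n y) atTop (𝓝 1) := by
    have := (t₁.comp hlim).mul tT
    rw [one_mul] at this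
    refine this.congr' ?_
    filter_upwards [eventually_gt_atTop 0] with y hy
    have := (rho_pos n (hT y hy).1).ne'
    simp only [Function.comp_apply]
    field_simp
  -- Sets up the second mean value: y = ρ^(n+1) as a function of ρ, so that Ty - y is expressed
  -- through the increment of ρ.
  have hpd : derivative (X ^ (n + 1) : ℝ[X]) = (C ((n : ℝ) + 1) * X ^ n) * derivative X := by
    simp
  have hmvt : ∀ y, ∃ ξ η, 0 < y → (ξ ∈ Set.uIcc (w₁ y) (w₁ (T y)) ∧
      η ∈ Set.uIcc (rho n y) (rho n (T y))) ∧
      (energy P₂).eval (w₂ y) - (energy P₁).eval (w₁ y) =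
        (slope P₁).eval ξ * ((C ((n : ℝ) + 1) * X ^ n).eval η * (rho n (T y) - rho n y)) := by
    intro y
    by_cases hy : 0 < y
    · obtain ⟨ξ, hξ, h⟩ := exists_eval_sub_eval_eq h₁.derivative_energy h₁.deriv_pos
        (hw₁ y hy).1 (hw₁ _ (hT y hy).1).1
      obtain ⟨η, hη, h'⟩ := exists_eval_sub_eval_eq hpd (by simp) (rho_pos n hy)
        (rho_pos n (hT y hy).1)
      refine ⟨ξ, η, fun _ => ⟨⟨hξ, hη⟩, ?_⟩⟩
      have heq : (energy P₁).eval (w₁ (T y)) = (energy P₂).eval (w₂ y) := by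
        have := (hT y hy).2
        field_simp at this
        exact this
      rw [heq, (hw₁ _ (hT y hy).1).2, (hw₁ y hy).2] at h
      simp only [eval_X_pow, eval_X, rho_pow n (hT y hy).1, rho_pow n hy] at h'
      rw [h, h']
    · exact ⟨0, 0, fun h => absurd h hy⟩
  choose ξ η hξη using hmvt
  have tξ : Tendsto (fun y => ξ y / rho n y) atTop (𝓝 1) := by
    refine tendsto_div_of_mem_uIcc hρpos t₁ t₁T ?_
    filter_upwards [eventually_gt_atTop 0] with y hy using (hξη y hy).1.1
  have tη : Tendsto (fun y => η y / rho n y) atTop (𝓝 1) := by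
    refine tendsto_div_of_mem_uIcc hρpos tρ tT ?_
    filter_upwards [eventually_gt_atTop 0] with y hy using (hξη y hy).1.2
  have l1 := tendsto_energy_sub hn h₁ h₂ hw₁ hw₂ hk hdeg
  have l2 := tendsto_eval_div_pow hρ tξ (h₁.natDegree_slope_le hn)
  have l3 := tendsto_eval_div_pow hρ tη (natDegree_C_mul_X_pow_le ((n : ℝ) + 1) n)
  rw [h₁.coeff_slope hn] at l2
  rw [coeff_C_mul_X_pow, if_pos rfl] at l3
  have l23 := l2.mul l3
  have hval : ((n : ℝ) + 1) * 1 ^ (n - 1) * ((n + 1) * 1 ^ n) = (n + 1) ^ 2 := by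
    simp only [one_pow]; ring
  rw [hval] at l23
  refine (l1.div l23 (by positivity)).congr' ?_
  filter_upwards [eventually_gt_atTop 0, l23.eventually_const_lt (by positivity : (0:ℝ) < _)]
    with y hy hden
  have hr := (rho_pos n hy).ne'
  simp only [Pi.div_apply]
  rw [div_eq_iff hden.ne', (hξη y hy).2]
  have hpow : rho n y ^ (n - 1) * rho n y ^ n = rho n y ^ (n + k - 1) * rho n y ^ (n - k) := by
    rw [← pow_add, ← pow_add]; congr 1; omega
  rw [div_mul_div_comm, hpow]
  field_simp

theorem power_orbit (hn : 1 ≤ n) (h₁ : IsAdmissible n P₁) (h₂ : IsAdmissible n P₂)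
    (hw₁ : IsPosInverse P₁ w₁) (hw₂ : IsPosInverse P₂ w₂) {a : ℝ} (ha : 0 < a)
    (hT : IsSlowRelation P₁ P₂ w₁ w₂ a a T) {ystar y₀ : ℝ} (hystar : 0 < ystar)
    (hy₀ : ystar < y₀) (hne : ∀ y, ystar < y →
      (energy P₁).eval (w₁ y) / a ≠ (energy P₂).eval (w₂ y) / a) (hk : 2 ≤ k) (hkn : k ≤ n)
    (hdeg : (P₂ - P₁).natDegree ≤ k) (hsign : 0 < (P₂ - P₁).coeff k * (1 + k - n)) :
    OrbitTendsToInfinity T y₀ ∧ MinkowskiNondegenerate (orbitAtInfinity n T y₀) ∧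
      HasMinkowskiDim (orbitAtInfinity n T y₀) (((n : ℝ) + 1 - k) / (n + 2 - k)) := by
  have hn' : (1 : ℝ) ≤ n := by exact_mod_cast hn
  have hk' : (2 : ℝ) ≤ k := by exact_mod_cast hk
  have hD : 0 < ((n : ℝ) + 1) * ((P₂ - P₁).coeff k * (1 + k - n)) / (n + k - 1) :=
    div_pos (mul_pos (by linarith) hsign) (by linarith)
  have hev : ∀ᶠ y in atTop,
      (energy P₁).eval (w₁ y) / a < (energy P₂).eval (w₂ y) / a := by
    filter_upwards [(tendsto_energy_sub hn h₁ h₂ hw₁ hw₂ hk hdeg).eventually_const_lt hD,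
      eventually_gt_atTop 0] with y hy hy0
    have := (div_pos_iff_of_pos_right (pow_pos (rho_pos n hy0) _)).1 hy
    exact div_lt_div_of_pos_right (by linarith) ha
  obtain ⟨hpos, horb⟩ := orbitTendsToInfinity_of_lt hystar hy₀ (h₁.strictMonoOn_integral hw₁ ha)
    (h₁.continuousOn_integral hw₁ a) (h₂.continuousOn_integral hw₂ a) hT hne hev
  refine ⟨horb, ?_⟩
  have hlim := tendsto_slowRelation h₁ hw₁ ha hT hev
  have hinc := tendsto_rho_increment hn h₁ h₂ hw₁ hw₂ ha hT hlim hk hkn hdeg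
  obtain ⟨c, hc, hcL⟩ := exists_between (div_pos hD (by positivity : (0 : ℝ) < (n + 1) ^ 2))
  obtain ⟨c', hc'⟩ := exists_gt
    (((n : ℝ) + 1) * ((P₂ - P₁).coeff k * (1 + k - n)) / (n + k - 1) / (n + 1) ^ 2)
  have main := minkowski_of_power_growth (ρ := fun l => rho n (T^[l] y₀))
    (fun i j hij => Real.rpow_le_rpow (hpos i).le (horb.1.monotone hij) (by positivity))
    (fun l => rho_pos n (hpos l)) ((tendsto_rho n).comp horb.2) (q := n + 1 - k) (by omega)
    (c := c) (C := c') hc (by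
      filter_upwards [horb.2.eventually (hinc.eventually_const_lt hcL),
        horb.2.eventually (hinc.eventually_lt_const hc')] with l hl hl'
      rw [Function.iterate_succ_apply', show n + 1 - k - 1 = n - k by omega]
      exact ⟨hl.le, hl'.le⟩)
  have hcast : ((n + 1 - k : ℕ) : ℝ) = (n : ℝ) + 1 - k := by
    rw [Nat.cast_sub (by omega)]; push_cast; rfl
  rw [hcast, show (n : ℝ) + 1 - k + 1 = n + 2 - k by ring] at main
  exact main

end

/-! ### The Liénard branches as admissible polynomials -/

/-- The polynomial `X ^ (n + 1) + ∑_{k=2}^n b_k X ^ k`. -/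
noncomputable def lienardPoly (n : ℕ) (b : ℕ → ℝ) : ℝ[X] :=
  X ^ (n + 1) + ∑ k ∈ Finset.Icc 2 n, C (b k) * X ^ k

theorem coeff_lienardPoly (n : ℕ) (b : ℕ → ℝ) (j : ℕ) :
    (lienardPoly n b).coeff j =
      (if j = n + 1 then 1 else 0) + if j ∈ Finset.Icc 2 n then b j else 0 := by
  simp only [lienardPoly, coeff_add, coeff_X_pow, finsetSum_coeff, coeff_C_mul, mul_ite, mul_one,
    mul_zero, Finset.sum_ite_eq]

theorem isAdmissible_lienardPoly {n : ℕ} {b : ℕ → ℝ} (hn : 1 ≤ n)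
    (h : ∀ x, 0 < x → 0 < (derivative (lienardPoly n b)).eval x) :
    IsAdmissible n (lienardPoly n b) where
  natDegree_le := by
    rw [natDegree_le_iff_coeff_eq_zero]
    intro N hN
    rw [coeff_lienardPoly, if_neg (by omega), if_neg (by simp; omega), add_zero]
  coeff_succ := by
    rw [coeff_lienardPoly, if_pos rfl, if_neg (by simp), add_zero]
  coeff_zero := by
    rw [coeff_lienardPoly, if_neg (by omega), if_neg (by simp), add_zero]
  coeff_one := by
    rw [coeff_lienardPoly, if_neg (by omega), if_neg (by simp), add_zero]
  deriv_pos := h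

theorem eval_lienardPoly (n : ℕ) (b : ℕ → ℝ) (x : ℝ) :
    (lienardPoly n b).eval x = FPlus n b x := by
  simp [lienardPoly, FPlus, eval_finsetSum]

/-- Reflection reduces the left branch to the right one: the sign of the leading term of F₋ is
absorbed and its other coefficients acquire (-1)^k. -/
theorem FPlus_reflected (n : ℕ) (b : ℕ → ℝ) (x : ℝ) :
    FPlus n (fun k => (-1) ^ k * b k) (-x) = FMinus n b x := by
  rw [FPlus, FMinus]
  congr 1
  · rw [neg_pow]
  · refine Finset.sum_congr rfl fun k _ => ?_
    have h1 : (-1 : ℝ) ^ k * (-1) ^ k = 1 := by rw [← mul_pow]; norm_num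
    rw [neg_pow x]
    linear_combination b k * x ^ k * h1

theorem hasDerivAt_FPlus (n : ℕ) (b : ℕ → ℝ) (x : ℝ) :
    HasDerivAt (FPlus n b) ((derivative (lienardPoly n b)).eval x) x := by
  have : FPlus n b = fun x => (lienardPoly n b).eval x :=
    funext fun x => (eval_lienardPoly n b x).symm
  rw [this]
  exact (lienardPoly n b).hasDerivAt x

theorem hasDerivAt_FMinus (n : ℕ) (b : ℕ → ℝ) (x : ℝ) :
    HasDerivAt (FMinus n b)
      (-(derivative (lienardPoly n fun k => (-1) ^ k * b k)).eval (-x)) x := by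
  have : FMinus n b = fun x => FPlus n (fun k => (-1) ^ k * b k) (-x) :=
    funext fun x => (FPlus_reflected n b x).symm
  rw [this]
  have := (hasDerivAt_FPlus n (fun k => (-1) ^ k * b k) (-x)).comp x (hasDerivAt_neg x)
  rw [mul_neg_one] at this
  exact this

theorem coeff_lienardPoly_sub (n : ℕ) (bm bp : ℕ → ℝ) (j : ℕ) :
    (lienardPoly n bp - lienardPoly n fun k => (-1) ^ k * bm k).coeff j =
      if j ∈ Finset.Icc 2 n then fCoeff bm bp j else 0 := by
  rw [coeff_sub, coeff_lienardPoly, coeff_lienardPoly, add_sub_add_left_eq_sub]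
  split_ifs
  · rw [fCoeff, pow_succ]; ring
  · simp

section

variable {n : ℕ} {b : ℕ → ℝ}

theorem isPosInverse_omega (h : IsAdmissible n (lienardPoly n b)) :
    IsPosInverse (lienardPoly n b) (omega (FPlus n b)) := fun y hy => by
  obtain ⟨x, hx, hxy⟩ := h.exists_eval_eq hy
  have hex : ∃ x ∈ Set.Ioi (0 : ℝ), FPlus n b x = y := ⟨x, hx, by rw [← eval_lienardPoly, hxy]⟩
  exact ⟨Function.invFunOn_mem hex, by rw [eval_lienardPoly]; exact Function.invFunOn_eq hex⟩

theorem isPosInverse_neg_alpha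
    (h : IsAdmissible n (lienardPoly n fun k => (-1) ^ k * b k)) :
    IsPosInverse (lienardPoly n fun k => (-1) ^ k * b k) (fun y => -alpha (FMinus n b) y) :=
  fun y hy => by
    obtain ⟨x, hx, hxy⟩ := h.exists_eval_eq hy
    have hex : ∃ x ∈ Set.Iio (0 : ℝ), FMinus n b x = y :=
      ⟨-x, neg_neg_of_pos hx, by rw [← FPlus_reflected, neg_neg, ← eval_lienardPoly, hxy]⟩
    refine ⟨neg_pos.2 (Function.invFunOn_mem hex), ?_⟩
    rw [eval_lienardPoly, FPlus_reflected]
    exact Function.invFunOn_eq hex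

theorem derivative_energy_eval {P : ℝ[X]} (h : P.coeff 1 = 0) (x : ℝ) :
    (derivative (energy P)).eval x = (derivative P).eval x ^ 2 / x := by
  rw [energy, derivative_antideriv, ← X_mul_slope h]
  simp only [eval_mul, eval_pow, eval_X]
  rcases eq_or_ne x 0 with rfl | hx
  -- At the origin both sides are 0, the right one by the convention that division by 0 gives 0; the
  -- identity of integrands thus holds everywhere.
  · simp
  · field_simp

theorem IPlus_eq (h : IsAdmissible n (lienardPoly n b)) (a y : ℝ) :
    IPlus (FPlus n b) (GLin a) y =
      -((energy (lienardPoly n b)).eval (omega (FPlus n b) y) / a) := by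
  have hint : ∀ x, deriv (FPlus n b) x ^ 2 / GLin a x =
      -((derivative (energy (lienardPoly n b))).eval x / a) := fun x => by
    rw [(hasDerivAt_FPlus n b x).deriv, derivative_energy_eval h.coeff_one, GLin, neg_mul,
      div_neg, div_div, mul_comm a]
  rw [IPlus]
  simp only [hint]
  rw [intervalIntegral.integral_eq_sub_of_hasDerivAt
    (f := fun x => -((energy (lienardPoly n b)).eval x / a))
    (fun x _ => (((energy (lienardPoly n b)).hasDerivAt x).div_const a).neg)
    (Continuous.intervalIntegrable (by fun_prop) _ _)]
  simp [eval_energy_zero]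

theorem IMinus_eq (h : IsAdmissible n (lienardPoly n fun k => (-1) ^ k * b k)) (a y : ℝ) :
    IMinus (FMinus n b) (GLin a) y =
      -((energy (lienardPoly n fun k => (-1) ^ k * b k)).eval (-alpha (FMinus n b) y) / a) := by
  set P := lienardPoly n fun k => (-1) ^ k * b k with hP
  have hint : ∀ x, deriv (FMinus n b) x ^ 2 / GLin a x =
      (derivative (energy P)).eval (-x) / a := fun x => by
    rw [(hasDerivAt_FMinus n b x).deriv, ← hP, derivative_energy_eval h.coeff_one, GLin, neg_sq,
      div_div, neg_mul, neg_mul, mul_comm a]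
  rw [IMinus]
  simp only [hint]
  rw [intervalIntegral.integral_eq_sub_of_hasDerivAt
    (f := fun x => -((energy P).eval (-x) / a))
    (fun x _ => ?_) (Continuous.intervalIntegrable (by fun_prop) _ _)]
  · simp [eval_energy_zero]
  · have := ((((energy P).hasDerivAt (-x)).comp x (hasDerivAt_neg x)).div_const a).neg
    rw [mul_neg_one, neg_div, neg_neg] at this
    exact this

end

/-- The energy takes every positive value on the positive half-line and each such point is `w₁` of
some level, so `invFunOn` returns a genuine solution. -/
theorem isSlowRelation_invFunOn {n : ℕ} {P₁ P₂ : ℝ[X]} {w₁ w₂ I₁ I₂ : ℝ → ℝ} {a₁ a₂ : ℝ}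
    (hn : 1 ≤ n) (h₁ : IsAdmissible n P₁) (h₂ : IsAdmissible n P₂)
    (hw₁ : IsPosInverse P₁ w₁) (hw₂ : IsPosInverse P₂ w₂) (ha₁ : 0 < a₁) (ha₂ : 0 < a₂)
    (hI₁ : ∀ y, I₁ y = -((energy P₁).eval (w₁ y) / a₁))
    (hI₂ : ∀ y, I₂ y = -((energy P₂).eval (w₂ y) / a₂)) :
    IsSlowRelation P₁ P₂ w₁ w₂ a₁ a₂ fun y => Function.invFunOn I₁ (Set.Ioi 0) (I₂ y) := by
  intro y hy
  obtain ⟨x, hx, hxv⟩ := h₁.exists_energy_eq hn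
    (mul_pos ha₁ (div_pos (h₂.energy_pos (hw₂ y hy).1) ha₂))
  have hex : ∃ z ∈ Set.Ioi (0 : ℝ), I₁ z = I₂ y := by
    refine ⟨P₁.eval x, h₁.eval_pos hx, ?_⟩
    rw [hI₁, hI₂, h₁.inverse_eval hw₁ hx, hxv, mul_div_cancel_left₀ _ ha₁.ne']
  exact ⟨Function.invFunOn_mem hex,
    neg_injective ((hI₁ _).symm.trans ((Function.invFunOn_eq hex).trans (hI₂ y)))⟩

end PWSLienard

/-! ### The main theorem -/

theorem theorem4 (n : ℕ) (hn : 1 ≤ n) (am ap : ℝ) (bm bp : ℕ → ℝ)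
    (ham : 0 < am) (hap : 0 < ap)
    (hbm : 2 ≤ n → 0 < bm 2) (hbp : 2 ≤ n → 0 < bp 2)
    (hFm : ∀ x : ℝ, x < 0 → deriv (FMinus n bm) x < 0)
    (hFp : ∀ x : ℝ, 0 < x → 0 < deriv (FPlus n bp) x)
    (H Hinv : ℝ → ℝ)
    (hH : H = slowRelation (FMinus n bm) (GLin am) (FPlus n bp) (GLin ap))
    (hHinv : Hinv = slowRelationInv (FMinus n bm) (GLin am) (FPlus n bp) (GLin ap))
    (ystar : ℝ) (hystar : 0 < ystar)
    (hI : ∀ y : ℝ, ystar < y →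
      ITotal (FMinus n bm) (GLin am) (FPlus n bp) (GLin ap) y ≠ 0)
    (y₀ : ℝ) (hy₀ : ystar < y₀) :
    ((ap < am →
        OrbitTendsToInfinity H y₀ ∧ HasMinkowskiDim (orbitAtInfinity n H y₀) 0) ∧
      (am < ap →
        OrbitTendsToInfinity Hinv y₀ ∧ HasMinkowskiDim (orbitAtInfinity n Hinv y₀) 0)) ∧
    (am = ap → ∀ k₀ : ℕ,
      IsGreatest {k : ℕ | 2 ≤ k ∧ k ≤ n ∧ fCoeff bm bp k ≠ 0} k₀ → k₀ + 1 ≠ n →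
      (0 < fCoeff bm bp k₀ * (1 + (k₀ : ℝ) - (n : ℝ)) →
        OrbitTendsToInfinity H y₀ ∧ MinkowskiNondegenerate (orbitAtInfinity n H y₀) ∧
          HasMinkowskiDim (orbitAtInfinity n H y₀)
            (((n : ℝ) + 1 - (k₀ : ℝ)) / ((n : ℝ) + 2 - (k₀ : ℝ)))) ∧
      (fCoeff bm bp k₀ * (1 + (k₀ : ℝ) - (n : ℝ)) < 0 →
        OrbitTendsToInfinity Hinv y₀ ∧ MinkowskiNondegenerate (orbitAtInfinity n Hinv y₀) ∧
          HasMinkowskiDim (orbitAtInfinity n Hinv y₀)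
            (((n : ℝ) + 1 - (k₀ : ℝ)) / ((n : ℝ) + 2 - (k₀ : ℝ))))) := by
  subst hH hHinv
  set bm' : ℕ → ℝ := fun k => (-1) ^ k * bm k with hbm'
  have hP : IsAdmissible n (lienardPoly n bp) := isAdmissible_lienardPoly hn fun x hx => by
    rw [← (hasDerivAt_FPlus n bp x).deriv]
    exact hFp x hx
  have hM : IsAdmissible n (lienardPoly n bm') := isAdmissible_lienardPoly hn fun x hx => by
    have := hFm (-x) (neg_neg_of_pos hx)
    rw [(hasDerivAt_FMinus n bm (-x)).deriv, neg_neg] at this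
    exact neg_neg_iff_pos.1 this
  have hwP := isPosInverse_omega hP
  have hwM := isPosInverse_neg_alpha hM
  have hIP := IPlus_eq hP ap
  have hIM := IMinus_eq hM am
  have hne : ∀ y, ystar < y →
      (Polynomial.eval (-alpha (FMinus n bm) y) (energy (lienardPoly n bm'))) / am ≠
        (Polynomial.eval (omega (FPlus n bp) y) (energy (lienardPoly n bp))) / ap := by
    intro y hy heq
    refine hI y hy ?_
    rw [ITotal, hIP, hIM, heq, sub_self]
  -- For `H` the reflected left branch comes first; for its inverse the two branches exchange roles.
  have hT := isSlowRelation_invFunOn hn hM hP hwM hwP ham hap hIM hIP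
  have hT' := isSlowRelation_invFunOn hn hP hM hwP hwM hap ham hIP hIM
  have hne' := fun y hy => (hne y hy).symm
  refine ⟨⟨fun h => geometric_orbit hn hM hP hwM hwP hap h hT hystar hy₀ hne,
    fun h => geometric_orbit hn hP hM hwP hwM ham h hT' hystar hy₀ hne'⟩, ?_⟩
  rintro rfl k₀ ⟨⟨hk2, hkn, -⟩, hmax⟩ -
  have hcoeff := coeff_lienardPoly_sub n bm bp k₀
  rw [if_pos (Finset.mem_Icc.2 ⟨hk2, hkn⟩)] at hcoeff
  have hdeg : (lienardPoly n bp - lienardPoly n bm').natDegree ≤ k₀ := by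
    rw [Polynomial.natDegree_le_iff_coeff_eq_zero]
    intro N hN
    rw [coeff_lienardPoly_sub]
    split_ifs with hmem
    · by_contra hne0
      rw [Finset.mem_Icc] at hmem
      exact absurd (hmax ⟨hmem.1, hmem.2, hne0⟩) (by omega)
    · rfl
  constructor
  · intro hs
    exact power_orbit hn hM hP hwM hwP ham hT hystar hy₀ hne hk2 hkn hdeg (by rwa [hcoeff])
  · intro hs
    -- Exchanging the branches negates P₂ - P₁, hence the sign condition.
    refine power_orbit hn hP hM hwP hwM ham hT' hystar hy₀ hne' hk2 hkn ?_ ?_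
    · rwa [← Polynomial.natDegree_neg, neg_sub]
    · rw [← neg_sub, Polynomial.coeff_neg, hcoeff]
      linarith
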